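/- Let $S_1,S_2$ be finite non-empty sets of pure strategies with $m_1$ and $m_2$ elements, let $u_1,u_2:S_1\times S_2\to\mathbb R$ be the payoff functions of a two-player game, and let $k\ge 1$ be an integer, $\beta\in(0,1)$ and $\varepsilon\in[0,1]$. Let $\square(S)=\Delta(S_1)\times\Delta(S_2)\subset\mathbb R^{m_1+m_2}$ be the product of the simplices of mixed strategies, with the Euclidean distance $|x-y|$ and its Borel $\sigma$-field, and let $\mathcal P(\square(S))$ be the set of Borel probability measures on it. For $i\in\{1,2\}$ let $-i$ be the other player. For $\sigma\in\Delta(S_{-i})$ let $BR_i(\sigma)\subset S_i$ be the set of pure strategies that maximize the expected payoff of player $i$ against $\sigma$. For $q\in\Delta(S_{-i})$ let $\widetilde{BR}_i(q)$ be the random element of $S_i$ obtained as follows: with probability $1-\varepsilon$, draw $k$ strategies independently from $q$, let $D\in\Delta(S_{-i})$ be their empirical distribution, and choose an element of $BR_i(D)$ uniformly at random; with probability $\varepsilon$, choose an element of $S_i$ uniformly at random. The Recency Weighted Sampler is the Markov chain on $\square(S)$ with transition kernel $$P\big((p_1,p_2),B\big)=\sum_{s_1\in S_1}\sum_{s_2\in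 S_2}\mathbb P\big(\widetilde{BR}_1(p_2)=s_1\big)\,\mathbb P\big(\widetilde{BR}_2(p_1)=s_2\big)\,1_B\big(\beta p_1+(1-\beta)\mathbf 1_{s_1},\ \beta p_2+(1-\beta)\mathbf 1_{s_2}\big),$$ where $\mathbf 1_{s}$ is the unit vector (vertex of the simplex) of the pure strategy $s$. For $\alpha\ge1$ let $$W_\alpha(\mu,\nu)=\Big(\inf_{\pi}\int |x-y|^\alpha\,\pi(dx,dy)\Big)^{1/\alpha},$$ where the infimum is over all couplings $\pi$ of $\mu$ and $\nu$, be the Wasserstein distance of order $\alpha$ on $\mathcal P(\square(S))$. **Theorem.** If $\varepsilon>0$ and $\beta\in\big(1-\max\{m_1,m_2\}^{-1},1\big)$, then the chain with kernel $P$ is uniformly ergodic, in the following sense: there are a unique $\mu^*_\varepsilon\in\mathcal P(\square(S))$ with $\mu^*_\varepsilon P=\mu^*_\varepsilon$ and a number $\theta\in(0,1)$ such that, for all $\alpha\ge1$, $$\big(W_\alpha(\nu P^n,\mu^*_\varepsilon)\big)^\alpha\le c\,\theta^n\qquad\text{for all }\nu\in\mathcal P(\square(S)),\ n\ge 0,$$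 where $c>0$ is a constant depending only on $\max_{x\in\square(S)}|x|$ and $\alpha$, and $\theta$ does not depend on $\alpha$, $\nu$ or $n$. -/

import Mathlib

open MeasureTheory ProbabilityTheory
open scoped ENNReal

noncomputable section

namespace RWS

section BestReply

variable {A B : Type*} [Fintype A] [Fintype B]

/-- Expected payoff of the own pure strategy `a` against the mixed strategy `σ` of the opponent,
for the payoff function `u` (own strategy first, opponent's strategy second). -/
def expectedPayoff (u : A → B → ℝ) (σ : B → ℝ) (a : A) : ℝ :=
  ∑ b, σ b * u a b

open Classical in
/-- The set of pure best replies to the mixed strategy `σ` of the opponent. -/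
def bestReplies (u : A → B → ℝ) (σ : B → ℝ) : Finset A :=
  Finset.univ.filter fun a => ∀ a', expectedPayoff u σ a' ≤ expectedPayoff u σ a

open Classical in
/-- The probability that `a` is chosen when a best reply to `σ` is drawn uniformly at random
from the set of all best replies. -/
def bestReplyProb (u : A → B → ℝ) (σ : B → ℝ) (a : A) : ℝ :=
  if a ∈ bestReplies u σ then 1 / ((bestReplies u σ).card : ℝ) else 0

open Classical in
/-- The empirical distribution of a sample of `k` plays of the opponent: the weight of `b` is the
number of times that `b` was sampled, divided by `k`. -/
def empirical {k : ℕ} (ω : Fin k → B) : B → ℝ :=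
  fun b => ((Finset.univ.filter fun j => ω j = b).card : ℝ) / k

/-- The probability that the player plays `a`: with probability `1 - ε` she draws `k` plays of the
opponent independently from `p`, and plays a uniformly chosen best reply to the empirical
distribution of the sample; with probability `ε` she plays a uniformly random strategy. -/
def playProb (u : A → B → ℝ) (k : ℕ) (ε : ℝ) (p : B → ℝ) (a : A) : ℝ :=
  (1 - ε) * (∑ ω : Fin k → B, (∏ j, p (ω j)) * bestReplyProb u (empirical ω) a)
    + ε / (Fintype.card A : ℝ)

end BestReply

/-- A finite two-player game (strategy sets `S₁` and `S₂`, payoffs `u₁` and `u₂`) together with the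
parameters of the Recency Weighted Sampler: sample size `k`, recency parameter `β`, error
rate `ε`. -/
structure Model (S₁ S₂ : Type*) where
  u₁ : S₁ → S₂ → ℝ
  u₂ : S₁ → S₂ → ℝ
  k : ℕ
  k_pos : 0 < k
  β : ℝ
  β_mem : β ∈ Set.Ioo (0 : ℝ) 1
  ε : ℝ
  ε_mem : ε ∈ Set.Icc (0 : ℝ) 1

/-- The product `Δ(S₁) × Δ(S₂)` of the two simplices, as a subset of the Euclidean space
`ℝ^(S₁ ⊔ S₂)`; it carries the Euclidean distance and the Borel σ-algebra. -/
abbrev Square (S₁ S₂ : Type*) [Fintype S₁] [Fintype S₂] : Type _ :=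
  {x : EuclideanSpace ℝ (S₁ ⊕ S₂) //
    (fun s => x (Sum.inl s)) ∈ stdSimplex ℝ S₁ ∧ (fun s => x (Sum.inr s)) ∈ stdSimplex ℝ S₂}

section Chain

variable {S₁ S₂ : Type*} [Fintype S₁] [Fintype S₂]

/-- The first component `p₁ ∈ Δ(S₁)` of a state. -/
def Square.p₁ (x : Square S₁ S₂) : S₁ → ℝ := fun s => x.1 (Sum.inl s)

/-- The second component `p₂ ∈ Δ(S₂)` of a state. -/
def Square.p₂ (x : Square S₁ S₂) : S₂ → ℝ := fun s => x.1 (Sum.inr s)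

open Classical in
/-- The state `(β p₁ + (1 - β) 1_{s₁}, β p₂ + (1 - β) 1_{s₂})` that follows the state
`x = (p₁, p₂)` when the strategies `s₁` and `s₂` are played. -/
def Model.next (M : Model S₁ S₂) (x : Square S₁ S₂) (s₁ : S₁) (s₂ : S₂) : Square S₁ S₂ :=
  ⟨WithLp.toLp 2 (Sum.elim
      (M.β • x.p₁ + (1 - M.β) • (Pi.single s₁ 1 : S₁ → ℝ))
      (M.β • x.p₂ + (1 - M.β) • (Pi.single s₂ 1 : S₂ → ℝ))),
    by
      have h := convex_stdSimplex ℝ S₁ x.2.1 (single_mem_stdSimplex ℝ s₁) M.β_mem.1.le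
        (sub_nonneg.2 M.β_mem.2.le) (by ring)
      exact h,
    by
      have h := convex_stdSimplex ℝ S₂ x.2.2 (single_mem_stdSimplex ℝ s₂) M.β_mem.1.le
        (sub_nonneg.2 M.β_mem.2.le) (by ring)
      exact h⟩

/-- The probability that `(s₁, s₂)` is played in the state `x`; the two players sample and choose
independently of each other, each from the record of the opposing role. -/
def Model.profileProb (M : Model S₁ S₂) (x : Square S₁ S₂) (s₁ : S₁) (s₂ : S₂) : ℝ :=
  playProb M.u₁ M.k M.ε x.p₂ s₁ * playProb (fun b a => M.u₂ a b) M.k M.ε x.p₁ s₂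

theorem Model.measurable_next (M : Model S₁ S₂) (s₁ : S₁) (s₂ : S₂) :
    Measurable fun x => M.next x s₁ s₂ := by
  refine Continuous.measurable ?_
  refine Continuous.subtype_mk ?_ _
  refine (PiLp.continuous_toLp 2 _).comp (continuous_pi ?_)
  rintro (s | s) <;> simp only [Sum.elim_inl, Sum.elim_inr, Pi.add_apply, Pi.smul_apply,
    Square.p₁, Square.p₂] <;> fun_prop

theorem Model.measurable_profileProb (M : Model S₁ S₂) (s₁ : S₁) (s₂ : S₂) :
    Measurable fun x => M.profileProb x s₁ s₂ := by
  refine Continuous.measurable ?_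
  unfold Model.profileProb playProb Square.p₁ Square.p₂
  fun_prop

/-- The transition kernel of the Recency Weighted Sampler:
`P(x, B) = ∑ s₁, ∑ s₂, ℙ(s₁ and s₂ are played in x) 1_B(next state)`. -/
def Model.kernel (M : Model S₁ S₂) : Kernel (Square S₁ S₂) (Square S₁ S₂) where
  toFun x := ∑ s₁, ∑ s₂, ENNReal.ofReal (M.profileProb x s₁ s₂) • Measure.dirac (M.next x s₁ s₂)
  measurable' := by
    refine Measure.measurable_of_measurable_coe _ fun t ht => ?_
    simp only [Measure.coe_finsetSum, Finset.sum_apply, Measure.smul_apply, smul_eq_mul]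
    refine Finset.measurable_fun_sum _ fun s₁ _ => Finset.measurable_fun_sum _ fun s₂ _ => ?_
    exact (M.measurable_profileProb s₁ s₂).ennreal_ofReal.mul
      ((Measure.measurable_coe ht).comp
        (Measure.measurable_dirac.comp (M.measurable_next s₁ s₂)))

end Chain

/-- The Wasserstein distance of order `q` between two measures on a metric space:
`W_q(μ, ν) = (inf_π ∫ d(x, y)^q dπ(x, y))^(1/q)`, with the infimum over all couplings `π` of `μ`
and `ν`. -/
def wasserstein {X : Type*} [PseudoEMetricSpace X] [MeasurableSpace X] (q : ℝ)
    (μ ν : Measure X) : ℝ≥0∞ :=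
  (⨅ (π : Measure (X × X)) (_ : π.map Prod.fst = μ ∧ π.map Prod.snd = ν),
    ∫⁻ z, edist z.1 z.2 ^ q ∂π) ^ (1 / q)

end RWS

end

/-!
Since `ε > 0`, every pure profile is played with a probability bounded below, and these
probabilities are Lipschitz in the state; hence `exp (-κ d(x, y)) p_s(x) ≤ p_s(y)` for some `κ`.
So two copies of the chain can be coupled to play the same profile with probability at least
`exp (-κ d)`, in which case their distance contracts by `β`. For the Lyapunov function
`1 - exp (-A d)`, which never exceeds one, a step of the coupled chain yields at most
`1 - exp (-(κ + A β) d)`. If `A` is so large that `κ + A β < A`, this is at most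
`θ (1 - exp (-A d))` on a space of finite diameter, for some `θ < 1`, so the order one
Wasserstein distance of the two laws decays like `θ ^ n`. By compactness and the Feller property
a limit point of the laws is invariant, and a diameter `D` gives `W_α ^ α ≤ D ^ (α - 1) W_1`.
-/

open Filter Topology
open scoped NNReal BoundedContinuousFunction

noncomputable section

namespace RWS

section Wasserstein

variable {X : Type*} [PseudoEMetricSpace X] [MeasurableSpace X] {μ ν : Measure X} {q : ℝ}

theorem wasserstein_rpow (hq : 0 < q) :
    wasserstein q μ ν ^ q = ⨅ (π : Measure (X × X))
      (_ : π.map Prod.fst = μ ∧ π.map Prod.snd = ν), ∫⁻ z, edist z.1 z.2 ^ q ∂π := by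
  rw [wasserstein, ← ENNReal.rpow_mul, one_div_mul_cancel hq.ne', ENNReal.rpow_one]

theorem wasserstein_rpow_le_lintegral (hq : 0 < q) {π : Measure (X × X)}
    (hfst : π.map Prod.fst = μ) (hsnd : π.map Prod.snd = ν) :
    wasserstein q μ ν ^ q ≤ ∫⁻ z, edist z.1 z.2 ^ q ∂π := by
  rw [wasserstein_rpow hq]
  exact iInf₂_le π ⟨hfst, hsnd⟩

theorem wasserstein_one_le_lintegral {π : Measure (X × X)}
    (hfst : π.map Prod.fst = μ) (hsnd : π.map Prod.snd = ν) :
    wasserstein 1 μ ν ≤ ∫⁻ z, edist z.1 z.2 ∂π := by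
  simpa only [ENNReal.rpow_one] using wasserstein_rpow_le_lintegral one_pos hfst hsnd

variable [IsProbabilityMeasure μ] [IsProbabilityMeasure ν]

theorem le_mul_wasserstein_one {a c : ℝ≥0∞} (hc : c ≠ ∞)
    (h : ∀ π : Measure (X × X), π.map Prod.fst = μ → π.map Prod.snd = ν →
      a ≤ c * ∫⁻ z, edist z.1 z.2 ∂π) :
    a ≤ c * wasserstein 1 μ ν := by
  have : Nonempty {π : Measure (X × X) // π.map Prod.fst = μ ∧ π.map Prod.snd = ν} :=
    ⟨μ.prod ν, by simp [Measure.map_fst_prod], by simp [Measure.map_snd_prod]⟩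
  rw [← ENNReal.rpow_one (wasserstein 1 μ ν), wasserstein_rpow one_pos, iInf_subtype',
    ENNReal.mul_iInf fun h => absurd h hc]
  refine le_iInf fun π => ?_
  simpa only [ENNReal.rpow_one] using h π π.2.1 π.2.2

variable [OpensMeasurableSpace X] [SecondCountableTopology X]

theorem edist_integral_le_mul_wasserstein_one {f : X → ℝ} {K : ℝ≥0} (hf : LipschitzWith K f)
    (hfμ : Integrable f μ) (hfν : Integrable f ν) :
    edist (∫ x, f x ∂μ) (∫ x, f x ∂ν) ≤ K * wasserstein 1 μ ν := by
  refine le_mul_wasserstein_one ENNReal.coe_ne_top ?_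
  rintro π rfl rfl
  have hfst : Integrable (fun z : X × X => f z.1) π := hfμ.comp_measurable measurable_fst
  have hsnd : Integrable (fun z : X × X => f z.2) π := hfν.comp_measurable measurable_snd
  rw [integral_map measurable_fst.aemeasurable hfμ.aestronglyMeasurable,
    integral_map measurable_snd.aemeasurable hfν.aestronglyMeasurable, edist_eq_enorm_sub,
    ← integral_sub hfst hsnd, ← lintegral_const_mul _ measurable_edist]
  refine (enorm_integral_le_lintegral_enorm _).trans (lintegral_mono fun z => ?_)
  rw [← edist_eq_enorm_sub]
  exact hf z.1 z.2

theorem wasserstein_rpow_le_mul_wasserstein_one {D : ℝ≥0∞} (hD : D ≠ ∞)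
    (hdist : ∀ x y : X, edist x y ≤ D) (hq : 1 ≤ q) :
    wasserstein q μ ν ^ q ≤ D ^ (q - 1) * wasserstein 1 μ ν := by
  have hq' : 0 ≤ q - 1 := sub_nonneg.2 hq
  refine le_mul_wasserstein_one (ENNReal.rpow_ne_top_of_nonneg hq' hD) fun π hfst hsnd => ?_
  calc wasserstein q μ ν ^ q
      ≤ ∫⁻ z, edist z.1 z.2 ^ q ∂π := wasserstein_rpow_le_lintegral (by positivity) hfst hsnd
    _ = ∫⁻ z, edist z.1 z.2 ^ (q - 1) * edist z.1 z.2 ∂π := by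
        refine lintegral_congr fun z => ?_
        conv_lhs => rw [← sub_add_cancel q 1,
          ENNReal.rpow_add_of_nonneg _ _ hq' zero_le_one, ENNReal.rpow_one]
    _ ≤ ∫⁻ z, D ^ (q - 1) * edist z.1 z.2 ∂π := by
        gcongr with z
        exact hdist z.1 z.2
    _ = D ^ (q - 1) * ∫⁻ z, edist z.1 z.2 ∂π := lintegral_const_mul _ measurable_edist

theorem tendsto_of_tendsto_wasserstein_one {ι : Type*} {l : Filter ι} [l.IsCountablyGenerated]
    {μs νs : ι → ProbabilityMeasure X} {μ : ProbabilityMeasure X} (hμ : Tendsto μs l (𝓝 μ))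
    (h : Tendsto (fun i => wasserstein 1 (μs i : Measure X) (νs i)) l (𝓝 0)) :
    Tendsto νs l (𝓝 μ) := by
  rw [tendsto_iff_forall_lipschitz_integral_tendsto] at hμ ⊢
  rintro f hbdd ⟨K, hK⟩
  have hint (ρ : ProbabilityMeasure X) : Integrable f (ρ : Measure X) :=
    BoundedContinuousFunction.integrable _ (⟨⟨f, hK.continuous⟩, hbdd⟩ : X →ᵇ ℝ)
  have hlim : Tendsto (fun i => K * wasserstein 1 (μs i : Measure X) (νs i)) l (𝓝 0) := by
    simpa using ENNReal.Tendsto.const_mul h (Or.inr ENNReal.coe_ne_top)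
  have hclose : Tendsto (fun i => edist (∫ x, f x ∂(μs i : Measure X))
      (∫ x, f x ∂(νs i : Measure X))) l (𝓝 0) :=
    tendsto_of_tendsto_of_tendsto_of_le_of_le tendsto_const_nhds hlim (fun _ => zero_le)
      fun i => edist_integral_le_mul_wasserstein_one hK (hint _) (hint _)
  refine (hμ f hbdd ⟨K, hK⟩).congr_dist ?_
  simpa only [dist_edist, ENNReal.toReal_zero, Function.comp_def] using
    (ENNReal.tendsto_toReal ENNReal.zero_ne_top).comp hclose

end Wasserstein

section KernelPow

variable {X Y : Type*} [MeasurableSpace X] [MeasurableSpace Y]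

theorem bind_pow_zero (P : Kernel X X) (ν : Measure X) : ν.bind ⇑(P ^ 0) = ν :=
  Measure.bind_dirac

theorem bind_pow_succ (P : Kernel X X) (ν : Measure X) (n : ℕ) :
    ν.bind ⇑(P ^ (n + 1)) = (ν.bind ⇑(P ^ n)).bind P := by
  rw [pow_succ']
  exact Measure.comp_assoc.symm

theorem bind_pow_succ' (P : Kernel X X) (ν : Measure X) (n : ℕ) :
    ν.bind ⇑(P ^ (n + 1)) = (ν.bind P).bind ⇑(P ^ n) := by
  rw [pow_succ]
  exact Measure.comp_assoc.symm

theorem invariant_pow {P : Kernel X X} {μ : Measure X} (hμ : P.Invariant μ) (n : ℕ) :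
    (P ^ n).Invariant μ := by
  induction n with
  | zero => exact bind_pow_zero P μ
  | succ n ih => exact pow_succ' P n ▸ hμ.comp ih

instance isMarkovKernel_pow (P : Kernel X X) [IsMarkovKernel P] (n : ℕ) :
    IsMarkovKernel (P ^ n) := by
  induction n with
  | zero => exact inferInstanceAs (IsMarkovKernel Kernel.id)
  | succ n ih => exact pow_succ P n ▸ inferInstanceAs (IsMarkovKernel ((P ^ n) ∘ₖ P))

theorem map_bind_of_semiconj {Q : Kernel Y Y} {P : Kernel X X} {g : Y → X} (hg : Measurable g)
    (h : Q.map g = P.comap g hg) (π : Measure Y) : (π.bind Q).map g = (π.map g).bind P := by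
  rw [← Measure.deterministic_comp_eq_map hg, ← Measure.deterministic_comp_eq_map hg,
    Measure.comp_assoc, Measure.comp_assoc, Kernel.deterministic_comp_eq_map,
    Kernel.comp_deterministic_eq_comap, h]

theorem map_bind_pow_of_semiconj {Q : Kernel Y Y} {P : Kernel X X} {g : Y → X}
    (hg : Measurable g) (h : Q.map g = P.comap g hg) (π : Measure Y) (n : ℕ) :
    (π.bind ⇑(Q ^ n)).map g = (π.map g).bind ⇑(P ^ n) := by
  induction n with
  | zero => simp only [bind_pow_zero]
  | succ n ih => rw [bind_pow_succ, map_bind_of_semiconj hg h, ih, bind_pow_succ]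

theorem lintegral_bind_pow_le {Q : Kernel Y Y} {V : Y → ℝ≥0∞} (hV : Measurable V) {ρ : ℝ≥0∞}
    (h : ∀ y, ∫⁻ z, V z ∂Q y ≤ ρ * V y) (π : Measure Y) (n : ℕ) :
    ∫⁻ z, V z ∂(π.bind ⇑(Q ^ n)) ≤ ρ ^ n * ∫⁻ z, V z ∂π := by
  induction n with
  | zero => rw [bind_pow_zero, pow_zero, one_mul]
  | succ n ih =>
    calc ∫⁻ z, V z ∂(π.bind ⇑(Q ^ (n + 1)))
        = ∫⁻ y, ∫⁻ z, V z ∂Q y ∂(π.bind ⇑(Q ^ n)) := by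
          rw [bind_pow_succ, Measure.lintegral_bind Q.measurable.aemeasurable hV.aemeasurable]
      _ ≤ ∫⁻ y, ρ * V y ∂(π.bind ⇑(Q ^ n)) := lintegral_mono h
      _ = ρ * ∫⁻ y, V y ∂(π.bind ⇑(Q ^ n)) := lintegral_const_mul _ hV
      _ ≤ ρ ^ (n + 1) * ∫⁻ z, V z ∂π := by
          rw [pow_succ', mul_assoc]
          gcongr

end KernelPow

section Feller

variable {X : Type*} [TopologicalSpace X] [MeasurableSpace X]

/-- The Feller property: averaging over one step of `P` preserves continuity. Test functions take
values in `ℝ≥0`, as in Mathlib's characterization of weak convergence. -/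
def IsFeller (P : Kernel X X) : Prop :=
  ∀ f : X →ᵇ ℝ≥0, Continuous fun x => ∫⁻ y, f y ∂P x

variable [OpensMeasurableSpace X]

/-- The law of the chain with kernel `P` one step after the law `μ`, as an element of the space of
probability measures with its weak topology. -/
def nextLaw (P : Kernel X X) [IsMarkovKernel P] (μ : ProbabilityMeasure X) :
    ProbabilityMeasure X :=
  ⟨(μ : Measure X).bind P, inferInstance⟩

theorem IsFeller.continuous_nextLaw [CompactSpace X] {P : Kernel X X} [IsMarkovKernel P]
    (hP : IsFeller P) :
    Continuous (nextLaw P) := by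
  refine continuous_iff_continuousAt.2 fun μ => ?_
  refine ProbabilityMeasure.tendsto_iff_forall_lintegral_tendsto.2 fun f => ?_
  have hfin (x : X) : ∫⁻ y, f y ∂P x ≠ ∞ :=
    (BoundedContinuousFunction.lintegral_lt_top_of_nnreal (P x) f).ne
  let g : X →ᵇ ℝ≥0 := BoundedContinuousFunction.mkOfCompact
    ⟨fun x => (∫⁻ y, f y ∂P x).toNNReal,
      ENNReal.continuousOn_toNNReal.comp_continuous (hP f) hfin⟩
  have hbind (ρ : ProbabilityMeasure X) :
      ∫⁻ x, f x ∂(nextLaw P ρ : Measure X) = ∫⁻ x, g x ∂(ρ : Measure X) := by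
    have hf : Measurable fun x => (f x : ℝ≥0∞) :=
      (ENNReal.continuous_coe.comp f.continuous).measurable
    refine (Measure.lintegral_bind P.measurable.aemeasurable hf.aemeasurable).trans ?_
    exact lintegral_congr fun x => (ENNReal.coe_toNNReal (hfin x)).symm
  simp only [hbind]
  exact ProbabilityMeasure.tendsto_iff_forall_lintegral_tendsto.1 tendsto_id g

end Feller

section Mixing

/-- `Q` moves a pair of points so that each coordinate, seen alone, moves according to `P`: this is
a Markovian coupling of two copies of the chain with kernel `P`. -/
structure IsCouplingKernel {X : Type*} [MeasurableSpace X] (Q : Kernel (X × X) (X × X))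
    (P : Kernel X X) : Prop where
  map_fst : Q.map Prod.fst = P.comap Prod.fst measurable_fst
  map_snd : Q.map Prod.snd = P.comap Prod.snd measurable_snd

/-- The chain with kernel `P` forgets its initial law at the geometric rate `θ`, uniformly over all
initial laws; forgetting is measured by the Wasserstein distance of order one. -/
def MixesGeometrically {X : Type*} [PseudoEMetricSpace X] [MeasurableSpace X] (P : Kernel X X)
    (C θ : ℝ) : Prop :=
  ∀ (ν ν' : Measure X) [IsProbabilityMeasure ν] [IsProbabilityMeasure ν'] (n : ℕ),
    wasserstein 1 (ν.bind ⇑(P ^ n)) (ν'.bind ⇑(P ^ n)) ≤ ENNReal.ofReal (C * θ ^ n)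

theorem IsCouplingKernel.mixesGeometrically {X : Type*} [PseudoEMetricSpace X] [MeasurableSpace X]
    {Q : Kernel (X × X) (X × X)} {P : Kernel X X} (hQ : IsCouplingKernel Q P)
    {V : X × X → ℝ≥0∞} (hV : Measurable V) (hV1 : ∀ z, V z ≤ 1) {C θ : ℝ} (hC : 0 ≤ C)
    (hθ : 0 ≤ θ) (hdist : ∀ z : X × X, edist z.1 z.2 ≤ ENNReal.ofReal C * V z)
    (hdrift : ∀ z, ∫⁻ z', V z' ∂Q z ≤ ENNReal.ofReal θ * V z) :
    MixesGeometrically P C θ := by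
  intro ν ν' _ _ n
  have hfst : ((ν.prod ν').bind ⇑(Q ^ n)).map Prod.fst = ν.bind ⇑(P ^ n) := by
    rw [map_bind_pow_of_semiconj measurable_fst hQ.map_fst, Measure.map_fst_prod, measure_univ,
      one_smul]
  have hsnd : ((ν.prod ν').bind ⇑(Q ^ n)).map Prod.snd = ν'.bind ⇑(P ^ n) := by
    rw [map_bind_pow_of_semiconj measurable_snd hQ.map_snd, Measure.map_snd_prod, measure_univ,
      one_smul]
  calc wasserstein 1 (ν.bind ⇑(P ^ n)) (ν'.bind ⇑(P ^ n))
      ≤ ∫⁻ z, edist z.1 z.2 ∂((ν.prod ν').bind ⇑(Q ^ n)) := wasserstein_one_le_lintegral hfst hsnd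
    _ ≤ ∫⁻ z, ENNReal.ofReal C * V z ∂((ν.prod ν').bind ⇑(Q ^ n)) := lintegral_mono hdist
    _ = ENNReal.ofReal C * ∫⁻ z, V z ∂((ν.prod ν').bind ⇑(Q ^ n)) := lintegral_const_mul _ hV
    _ ≤ ENNReal.ofReal C * (ENNReal.ofReal θ ^ n * ∫⁻ z, V z ∂(ν.prod ν')) := by
        gcongr
        exact lintegral_bind_pow_le hV hdrift _ n
    _ ≤ ENNReal.ofReal C * (ENNReal.ofReal θ ^ n * 1) := by
        gcongr
        exact (lintegral_mono hV1).trans_eq (by simp)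
    _ = ENNReal.ofReal (C * θ ^ n) := by
        rw [mul_one, ENNReal.ofReal_mul hC, ENNReal.ofReal_pow hθ]

theorem MixesGeometrically.tendsto_wasserstein {X : Type*} [PseudoEMetricSpace X]
    [MeasurableSpace X] {P : Kernel X X} {C θ : ℝ} (hP : MixesGeometrically P C θ)
    (hθ : θ ∈ Set.Ioo (0 : ℝ) 1) (ν ν' : Measure X) [IsProbabilityMeasure ν]
    [IsProbabilityMeasure ν'] :
    Tendsto (fun n => wasserstein 1 (ν.bind ⇑(P ^ n)) (ν'.bind ⇑(P ^ n))) atTop (𝓝 0) := by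
  have hlim : Tendsto (fun n : ℕ => ENNReal.ofReal (C * θ ^ n)) atTop (𝓝 0) := by
    simpa using ENNReal.tendsto_ofReal
      ((tendsto_pow_atTop_nhds_zero_of_lt_one hθ.1.le hθ.2).const_mul C)
  exact tendsto_of_tendsto_of_tendsto_of_le_of_le tendsto_const_nhds hlim (fun _ => zero_le)
    fun n => hP ν ν' n

theorem MixesGeometrically.exists_invariant {X : Type*} [MetricSpace X] [CompactSpace X]
    [Nonempty X] [MeasurableSpace X] [BorelSpace X] {P : Kernel X X} [IsMarkovKernel P] {C θ : ℝ}
    (hP : MixesGeometrically P C θ) (hθ : θ ∈ Set.Ioo (0 : ℝ) 1) (hFeller : IsFeller P) :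
    ∃ μ : Measure X, IsProbabilityMeasure μ ∧ P.Invariant μ := by
  obtain ⟨x₀⟩ := ‹Nonempty X›
  let ν : Measure X := Measure.dirac x₀
  let law (n : ℕ) : ProbabilityMeasure X := ⟨ν.bind ⇑(P ^ n), inferInstance⟩
  obtain ⟨μ, φ, hφ, hlim⟩ := CompactSpace.tendsto_subseq law
  have hnext (n : ℕ) : (nextLaw P (law n) : Measure X) = (ν.bind P).bind ⇑(P ^ n) :=
    (bind_pow_succ P ν n).symm.trans (bind_pow_succ' P ν n)
  have hclose : Tendsto
      (fun n => wasserstein 1 (law (φ n) : Measure X) (nextLaw P (law (φ n)))) atTop (𝓝 0) := by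
    simp only [hnext]
    exact (hP.tendsto_wasserstein hθ ν (ν.bind P)).comp hφ.tendsto_atTop
  have hfix : nextLaw P μ = μ := tendsto_nhds_unique
    ((hFeller.continuous_nextLaw.tendsto μ).comp hlim)
    (tendsto_of_tendsto_wasserstein_one hlim hclose)
  exact ⟨μ, inferInstance, congrArg Subtype.val hfix⟩

theorem MixesGeometrically.invariant_unique {X : Type*} [MetricSpace X] [MeasurableSpace X]
    [BorelSpace X] [SecondCountableTopology X] {P : Kernel X X} {C θ : ℝ}
    (hP : MixesGeometrically P C θ) (hθ : θ ∈ Set.Ioo (0 : ℝ) 1) {μ μ' : Measure X}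
    [IsProbabilityMeasure μ] [IsProbabilityMeasure μ'] (hμ : P.Invariant μ)
    (hμ' : P.Invariant μ') : μ' = μ := by
  have hdist : Tendsto (fun _ : ℕ => wasserstein 1 μ μ') atTop (𝓝 0) := by
    simpa only [(invariant_pow hμ _).def, (invariant_pow hμ' _).def] using
      hP.tendsto_wasserstein hθ μ μ'
  let ρ : ProbabilityMeasure X := ⟨μ, ‹_›⟩
  let ρ' : ProbabilityMeasure X := ⟨μ', ‹_›⟩
  have hlim : Tendsto (fun _ : ℕ => ρ') atTop (𝓝 ρ) :=
    tendsto_of_tendsto_wasserstein_one (μs := fun _ => ρ) tendsto_const_nhds hdist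
  have hρ : ρ' = ρ := tendsto_nhds_unique tendsto_const_nhds hlim
  exact congrArg Subtype.val hρ

theorem MixesGeometrically.wasserstein_rpow_le {X : Type*} [PseudoMetricSpace X]
    [MeasurableSpace X] [OpensMeasurableSpace X] [SecondCountableTopology X] {P : Kernel X X}
    [IsMarkovKernel P] {C θ : ℝ} (hP : MixesGeometrically P C θ)
    {D : ℝ} (hD : ∀ x y : X, dist x y ≤ D) (hD0 : 0 ≤ D) {μ : Measure X} [IsProbabilityMeasure μ]
    (hμ : P.Invariant μ) {α : ℝ} (hα : 1 ≤ α) (ν : Measure X) [IsProbabilityMeasure ν] (n : ℕ) :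
    wasserstein α (ν.bind ⇑(P ^ n)) μ ^ α ≤ ENNReal.ofReal (D ^ (α - 1) * (C * θ ^ n)) := by
  have hedist (x y : X) : edist x y ≤ ENNReal.ofReal D := by
    rw [edist_dist]
    exact ENNReal.ofReal_le_ofReal (hD x y)
  calc wasserstein α (ν.bind ⇑(P ^ n)) μ ^ α
      ≤ ENNReal.ofReal D ^ (α - 1) * wasserstein 1 (ν.bind ⇑(P ^ n)) (μ.bind ⇑(P ^ n)) := by
        rw [(invariant_pow hμ n).def]
        exact wasserstein_rpow_le_mul_wasserstein_one ENNReal.ofReal_ne_top hedist hα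
    _ ≤ ENNReal.ofReal D ^ (α - 1) * ENNReal.ofReal (C * θ ^ n) := by
        gcongr
        exact hP ν μ n
    _ = ENNReal.ofReal (D ^ (α - 1) * (C * θ ^ n)) := by
        rw [ENNReal.ofReal_rpow_of_nonneg hD0 (sub_nonneg.2 hα),
          ← ENNReal.ofReal_mul (by positivity)]

end Mixing

section IfsKernel

/-- The product map applied to a pair of points by two copies of an iterated function system that
play `i.1` and `i.2`. -/
def pairMap {X S : Type*} (F : S → X → X) (i : S × S) (z : X × X) : X × X := (F i.1 z.1, F i.2 z.2)

theorem measurable_pairMap {X S : Type*} [MeasurableSpace X] {F : S → X → X}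
    (hF : ∀ s, Measurable (F s)) (i : S × S) :
    Measurable (pairMap F i) :=
  ((hF _).comp measurable_fst).prodMk ((hF _).comp measurable_snd)

variable {X S : Type*} [Fintype S] [MeasurableSpace X]

/-- The kernel of an iterated function system with place-dependent probabilities: from `x` the chain
moves to `F s x` with probability `p s x`. -/
def ifsKernel (p : S → X → ℝ) (F : S → X → X) (hp : ∀ s, Measurable (p s))
    (hF : ∀ s, Measurable (F s)) : Kernel X X where
  toFun x := ∑ s, ENNReal.ofReal (p s x) • Measure.dirac (F s x)
  measurable' := by
    refine Measure.measurable_of_measurable_coe _ fun t ht => ?_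
    simp only [Measure.coe_finsetSum, Finset.sum_apply, Measure.smul_apply, smul_eq_mul]
    refine Finset.measurable_fun_sum _ fun s _ => ?_
    exact (hp s).ennreal_ofReal.mul
      ((Measure.measurable_coe ht).comp (Measure.measurable_dirac.comp (hF s)))

variable {p : S → X → ℝ} {F : S → X → X} {hp : ∀ s, Measurable (p s)}
  {hF : ∀ s, Measurable (F s)}

theorem lintegral_ifsKernel {f : X → ℝ≥0∞} (hf : Measurable f) (x : X) :
    ∫⁻ y, f y ∂(ifsKernel p F hp hF x) = ∑ s, ENNReal.ofReal (p s x) * f (F s x) := by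
  change ∫⁻ y, f y ∂(∑ s, ENNReal.ofReal (p s x) • Measure.dirac (F s x)) = _
  rw [lintegral_finsetSum_measure]
  simp only [lintegral_smul_measure, lintegral_dirac' _ hf, smul_eq_mul]

theorem lintegral_ofReal_ifsKernel (hp0 : ∀ s x, 0 ≤ p s x) {f : X → ℝ} (hf : Measurable f)
    (hf0 : ∀ x, 0 ≤ f x) (x : X) :
    ∫⁻ y, ENNReal.ofReal (f y) ∂(ifsKernel p F hp hF x) =
      ENNReal.ofReal (∑ s, p s x * f (F s x)) := by
  rw [lintegral_ifsKernel hf.ennreal_ofReal,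
    ENNReal.ofReal_sum_of_nonneg fun s _ => mul_nonneg (hp0 s x) (hf0 _)]
  simp only [ENNReal.ofReal_mul (hp0 _ x)]

theorem isMarkovKernel_ifsKernel (hp0 : ∀ s x, 0 ≤ p s x) (hp1 : ∀ x, ∑ s, p s x = 1) :
    IsMarkovKernel (ifsKernel p F hp hF) := by
  refine ⟨fun x => ⟨?_⟩⟩
  rw [← lintegral_one, lintegral_ifsKernel measurable_const]
  simp only [mul_one]
  rw [← ENNReal.ofReal_sum_of_nonneg fun s _ => hp0 s x, hp1, ENNReal.ofReal_one]

theorem isFeller_ifsKernel [TopologicalSpace X] [OpensMeasurableSpace X]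
    (hpc : ∀ s, Continuous (p s)) (hFc : ∀ s, Continuous (F s)) :
    IsFeller (ifsKernel p F hp hF) := by
  intro f
  have hf : Continuous fun x => (f x : ℝ≥0∞) := ENNReal.continuous_coe.comp f.continuous
  have hsum (x : X) : ∫⁻ y, f y ∂(ifsKernel p F hp hF x) =
      ((∑ s, Real.toNNReal (p s x) * f (F s x) : ℝ≥0) : ℝ≥0∞) := by
    rw [lintegral_ifsKernel hf.measurable, ENNReal.ofNNReal_finsetSum]
    simp only [ENNReal.coe_mul, ENNReal.ofReal]
  simp only [hsum]
  fun_prop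

theorem isCouplingKernel_ifsKernel {w : S × S → X × X → ℝ} {hw : ∀ i, Measurable (w i)}
    (hw0 : ∀ i z, 0 ≤ w i z) (hfst : ∀ s z, ∑ t, w (s, t) z = p s z.1)
    (hsnd : ∀ t z, ∑ s, w (s, t) z = p t z.2) :
    IsCouplingKernel (ifsKernel w (pairMap F) hw (measurable_pairMap hF))
      (ifsKernel p F hp hF) where
  map_fst := by
    refine Kernel.ext_fun fun z f hf => ?_
    rw [Kernel.lintegral_map _ measurable_fst _ hf, Kernel.lintegral_comap,
      lintegral_ifsKernel (f := fun z : X × X => f z.1) (hf.comp measurable_fst),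
      lintegral_ifsKernel hf, Fintype.sum_prod_type]
    refine Finset.sum_congr rfl fun s _ => ?_
    rw [← hfst, ENNReal.ofReal_sum_of_nonneg fun t _ => hw0 _ _, Finset.sum_mul]
    rfl
  map_snd := by
    refine Kernel.ext_fun fun z f hf => ?_
    rw [Kernel.lintegral_map _ measurable_snd _ hf, Kernel.lintegral_comap,
      lintegral_ifsKernel (f := fun z : X × X => f z.2) (hf.comp measurable_snd),
      lintegral_ifsKernel hf, Fintype.sum_prod_type_right]
    refine Finset.sum_congr rfl fun t _ => ?_
    rw [← hsnd, ENNReal.ofReal_sum_of_nonneg fun s _ => hw0 _ _, Finset.sum_mul]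
    rfl

end IfsKernel

section OverlapCoupling

variable {S : Type*} [DecidableEq S]

/-- A coupling of the probability vectors `a` and `b` that plays the same strategy in both copies
with probability at least `r`; it is meant for `0 ≤ r` and `r • a ≤ b`. Unlike the maximal coupling,
it needs no division by the total variation distance of `a` and `b`. -/
def overlapCoupling (r : ℝ) (a b : S → ℝ) (i : S × S) : ℝ :=
  (if i.1 = i.2 then r * a i.1 else 0) + a i.1 * (b i.2 - r * a i.2)

variable {r : ℝ} {a b : S → ℝ}

theorem overlapCoupling_nonneg (hr : 0 ≤ r) (ha : ∀ s, 0 ≤ a s) (hab : ∀ s, r * a s ≤ b s)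
    (i : S × S) : 0 ≤ overlapCoupling r a b i := by
  have hdiag : 0 ≤ r * a i.1 := mul_nonneg hr (ha _)
  refine add_nonneg ?_ (mul_nonneg (ha _) (sub_nonneg.2 (hab _)))
  split_ifs <;> positivity

variable [Fintype S]

theorem sum_overlapCoupling_snd (ha : ∑ s, a s = 1) (hb : ∑ s, b s = 1) (s : S) :
    ∑ t, overlapCoupling r a b (s, t) = a s := by
  simp only [overlapCoupling, Finset.sum_add_distrib, Finset.sum_ite_eq, Finset.mem_univ, if_true,
    ← Finset.mul_sum, Finset.sum_sub_distrib, ha, hb]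
  ring

theorem sum_overlapCoupling_fst (ha : ∑ s, a s = 1) (t : S) :
    ∑ s, overlapCoupling r a b (s, t) = b t := by
  simp only [overlapCoupling, Finset.sum_add_distrib, Finset.sum_ite_eq', Finset.mem_univ, if_true,
    ← Finset.sum_mul, ha]
  ring

theorem sum_overlapCoupling_mul_le (hr : 0 ≤ r) (ha0 : ∀ s, 0 ≤ a s) (ha : ∑ s, a s = 1)
    (hb : ∑ s, b s = 1) (hab : ∀ s, r * a s ≤ b s) {f : S × S → ℝ} (hf : ∀ i, f i ≤ 1) {c : ℝ}
    (hdiag : ∀ s, f (s, s) ≤ c) :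
    ∑ i, overlapCoupling r a b i * f i ≤ r * c + (1 - r) := by
  have hsame : ∑ s, r * a s * f (s, s) ≤ r * c := by
    calc ∑ s, r * a s * f (s, s) ≤ ∑ s, r * a s * c :=
          Finset.sum_le_sum fun s _ => mul_le_mul_of_nonneg_left (hdiag s) (mul_nonneg hr (ha0 s))
      _ = r * c := by rw [← Finset.sum_mul, ← Finset.mul_sum, ha, mul_one]
  have hindep : ∑ s, ∑ t, a s * (b t - r * a t) * f (s, t) ≤ 1 - r := by
    calc ∑ s, ∑ t, a s * (b t - r * a t) * f (s, t) ≤ ∑ s, ∑ t, a s * (b t - r * a t) :=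
          Finset.sum_le_sum fun s _ => Finset.sum_le_sum fun t _ =>
            mul_le_of_le_one_right (mul_nonneg (ha0 s) (sub_nonneg.2 (hab t))) (hf _)
      _ = 1 - r := by
          simp only [← Finset.mul_sum, Finset.sum_sub_distrib, ← Finset.sum_mul, ha, hb, one_mul,
            mul_one]
  simp only [Fintype.sum_prod_type, overlapCoupling, add_mul, Finset.sum_add_distrib, ite_mul,
    zero_mul, Finset.sum_ite_eq, Finset.mem_univ, if_true]
  exact add_le_add hsame hindep

end OverlapCoupling

section Exp

theorem one_sub_exp_neg_mul_le {b t T : ℝ} (hb : b ≤ 1) (ht : 0 ≤ t) (htT : t ≤ T) :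
    1 - Real.exp (-(b * t)) ≤ (1 - (1 - b) * Real.exp (-T)) * (1 - Real.exp (-t)) := by
  have hgap : Real.exp (-T) * ((1 - b) * (1 - Real.exp (-t))) ≤
      Real.exp (-t) * (Real.exp ((1 - b) * t) - 1) := by
    have hexp_t : Real.exp (-t) ≤ 1 := Real.exp_le_one_iff.2 (by linarith)
    have hlin : 1 - Real.exp (-t) ≤ t := by linarith [Real.add_one_le_exp (-t)]
    refine mul_le_mul (Real.exp_le_exp.2 (by linarith)) ?_
      (mul_nonneg (by linarith) (by linarith)) (Real.exp_nonneg _)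
    calc (1 - b) * (1 - Real.exp (-t)) ≤ (1 - b) * t := by gcongr
      _ ≤ Real.exp ((1 - b) * t) - 1 := by linarith [Real.add_one_le_exp ((1 - b) * t)]
  have hsplit : Real.exp (-(b * t)) = Real.exp (-t) * Real.exp ((1 - b) * t) := by
    rw [← Real.exp_add]
    ring_nf
  rw [hsplit]
  linarith

theorem le_add_one_mul_one_sub_exp_neg {t D : ℝ} (ht : 0 ≤ t) (htD : t ≤ D) :
    t ≤ (D + 1) * (1 - Real.exp (-t)) := by
  have hexp : Real.exp (-t) * (t + 1) ≤ 1 := by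
    calc Real.exp (-t) * (t + 1) ≤ Real.exp (-t) * Real.exp t := by
          gcongr
          exact Real.add_one_le_exp t
      _ = 1 := by rw [← Real.exp_add, neg_add_cancel, Real.exp_zero]
  have hle : Real.exp (-t) ≤ 1 := Real.exp_le_one_iff.2 (by linarith)
  calc t ≤ (t + 1) * (1 - Real.exp (-t)) := by linarith
    _ ≤ (D + 1) * (1 - Real.exp (-t)) := by gcongr

theorem exp_neg_mul_le_of_lipschitzWith {X : Type*} [PseudoMetricSpace X] {f : X → ℝ} {K : ℝ≥0}
    (hf : LipschitzWith K f) {δ : ℝ} (hδ : 0 < δ) (hδf : ∀ x, δ ≤ f x) (x y : X) :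
    Real.exp (-(K / δ * dist x y)) * f x ≤ f y := by
  have hf0 : 0 ≤ f y := hδ.le.trans (hδf y)
  rw [Real.exp_neg, inv_mul_le_iff₀ (Real.exp_pos _)]
  calc f x ≤ f y + K * dist x y := by
        have := (le_abs_self _).trans (hf.dist_le_mul x y)
        linarith
    _ = f y + K / δ * dist x y * δ := by field_simp
    _ ≤ f y + K / δ * dist x y * f y := by
        gcongr
        exact hδf y
    _ = (K / δ * dist x y + 1) * f y := by ring
    _ ≤ Real.exp (K / δ * dist x y) * f y := by
        gcongr
        exact Real.add_one_le_exp _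

end Exp

section ContractingIfs

variable {X S : Type*} [PseudoMetricSpace X] {p : S → X → ℝ} {F : S → X → X}
  {κ β A D : ℝ}

/-- The distance between the two components of `z`, rescaled by the bounded concave function
`t ↦ 1 - exp (-A t)`. This is the Lyapunov function of the coupled chain. -/
def expDist (A : ℝ) (z : X × X) : ℝ := 1 - Real.exp (-(A * dist z.1 z.2))

theorem expDist_nonneg (hA : 0 ≤ A) (z : X × X) : 0 ≤ expDist A z :=
  sub_nonneg.2 (Real.exp_le_one_iff.2 (neg_nonpos.2 (by positivity)))

theorem expDist_le_one (z : X × X) : expDist A z ≤ 1 :=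
  sub_le_self _ (Real.exp_nonneg _)

theorem measurable_expDist [MeasurableSpace X] [OpensMeasurableSpace X]
    [SecondCountableTopology X] : Measurable (expDist A : X × X → ℝ) := by
  unfold expDist
  fun_prop

theorem dist_le_mul_expDist (hA : 1 ≤ A) (hD : ∀ x y : X, dist x y ≤ D) (z : X × X) :
    dist z.1 z.2 ≤ (D + 1) * expDist A z := by
  have hD0 : 0 ≤ D := dist_nonneg.trans (hD z.1 z.2)
  calc dist z.1 z.2 ≤ (D + 1) * (1 - Real.exp (-dist z.1 z.2)) :=
        le_add_one_mul_one_sub_exp_neg dist_nonneg (hD _ _)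
    _ ≤ (D + 1) * expDist A z := by
        unfold expDist
        gcongr
        exact le_mul_of_one_le_left dist_nonneg hA

section PairWeight

variable [DecidableEq S]

/-- The weights with which two copies of the iterated function system with probabilities `p` are
coupled: the common part of `p · x` and `p · y` is taken to be `exp (-κ dist x y)`. -/
def pairWeight (κ : ℝ) (p : S → X → ℝ) (i : S × S) (z : X × X) : ℝ :=
  overlapCoupling (Real.exp (-(κ * dist z.1 z.2))) (p · z.1) (p · z.2) i

theorem measurable_pairWeight [MeasurableSpace X] [OpensMeasurableSpace X]
    [SecondCountableTopology X] (hp : ∀ s, Measurable (p s)) (i : S × S) :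
    Measurable (pairWeight κ p i) := by
  unfold pairWeight overlapCoupling
  by_cases h : i.1 = i.2
  · simp only [h, if_true]
    fun_prop
  · simp only [h, if_false]
    fun_prop

variable [Fintype S]

theorem sum_pairWeight_mul_expDist_le (hA : 1 ≤ A) (hκA : κ ≤ A * ((1 - β) / 2)) (hβ : β ≤ 1)
    (hp0 : ∀ s x, 0 ≤ p s x) (hp1 : ∀ x, ∑ s, p s x = 1)
    (hlog : ∀ s x y, Real.exp (-(κ * dist x y)) * p s x ≤ p s y)
    (hF : ∀ s x y, dist (F s x) (F s y) ≤ β * dist x y) (hD : ∀ x y : X, dist x y ≤ D)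
    (z : X × X) :
    ∑ i, pairWeight κ p i z * expDist A (pairMap F i z) ≤
      (1 - (1 - β) / 2 * Real.exp (-(A * D))) * expDist A z := by
  set d := dist z.1 z.2
  have hd : 0 ≤ d := dist_nonneg
  have hdiag (s : S) : expDist A (pairMap F (s, s) z) ≤ 1 - Real.exp (-(A * (β * d))) := by
    unfold expDist
    gcongr
    exact hF s z.1 z.2
  calc ∑ i, pairWeight κ p i z * expDist A (pairMap F i z)
      ≤ Real.exp (-(κ * d)) * (1 - Real.exp (-(A * (β * d)))) + (1 - Real.exp (-(κ * d))) :=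
        sum_overlapCoupling_mul_le (Real.exp_nonneg _) (fun s => hp0 s _) (hp1 _) (hp1 _)
          (fun s => hlog s _ _) (fun _ => expDist_le_one _) hdiag
    _ = 1 - Real.exp (-(κ * d + A * (β * d))) := by
        rw [neg_add, Real.exp_add]
        ring
    _ ≤ 1 - Real.exp (-((1 - (1 - β) / 2) * (A * d))) := by
        gcongr
        linarith [mul_le_mul_of_nonneg_right hκA hd]
    _ ≤ (1 - (1 - (1 - (1 - β) / 2)) * Real.exp (-(A * D))) * (1 - Real.exp (-(A * d))) :=
        one_sub_exp_neg_mul_le (by linarith) (by positivity) (by gcongr; exact hD _ _)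
    _ = (1 - (1 - β) / 2 * Real.exp (-(A * D))) * expDist A z := by
        rw [sub_sub_cancel]
        rfl

end PairWeight

theorem exists_mixesGeometrically_ifsKernel [Fintype S] [MeasurableSpace X]
    [OpensMeasurableSpace X] [SecondCountableTopology X] (hβ0 : 0 ≤ β) (hβ1 : β < 1)
    (hp0 : ∀ s x, 0 ≤ p s x) (hp1 : ∀ x, ∑ s, p s x = 1)
    (hlog : ∀ s x y, Real.exp (-(κ * dist x y)) * p s x ≤ p s y)
    (hF : ∀ s x y, dist (F s x) (F s y) ≤ β * dist x y) (hD0 : 0 ≤ D)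
    (hD : ∀ x y : X, dist x y ≤ D) (hpm : ∀ s, Measurable (p s)) (hFm : ∀ s, Measurable (F s)) :
    ∃ θ ∈ Set.Ioo (0 : ℝ) 1, MixesGeometrically (ifsKernel p F hpm hFm) (D + 1) θ := by
  classical
  obtain ⟨A, hA, hκA⟩ : ∃ A, 1 ≤ A ∧ κ ≤ A * ((1 - β) / 2) :=
    ⟨max 1 (κ / ((1 - β) / 2)), le_max_left _ _,
      (div_le_iff₀ (by linarith)).1 (le_max_right _ _)⟩
  have hexp : Real.exp (-(A * D)) ≤ 1 := Real.exp_le_one_iff.2 (neg_nonpos.2 (by positivity))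
  have hθ : 1 - (1 - β) / 2 * Real.exp (-(A * D)) ∈ Set.Ioo (0 : ℝ) 1 := by
    constructor <;> nlinarith [Real.exp_pos (-(A * D))]
  have hw0 (i : S × S) (z : X × X) : 0 ≤ pairWeight κ p i z :=
    overlapCoupling_nonneg (Real.exp_nonneg _) (hp0 · _) (hlog · _ _) i
  have hQ : IsCouplingKernel (ifsKernel (pairWeight κ p) (pairMap F) (measurable_pairWeight hpm)
      (measurable_pairMap hFm)) (ifsKernel p F hpm hFm) :=
    isCouplingKernel_ifsKernel hw0 (fun s _ => sum_overlapCoupling_snd (hp1 _) (hp1 _) s)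
      (fun t _ => sum_overlapCoupling_fst (hp1 _) t)
  refine ⟨_, hθ, hQ.mixesGeometrically (V := fun z => ENNReal.ofReal (expDist A z))
    measurable_expDist.ennreal_ofReal (fun z => ?_) (by linarith) hθ.1.le (fun z => ?_)
    fun z => ?_⟩
  · exact ENNReal.ofReal_le_one.2 (expDist_le_one z)
  · rw [← ENNReal.ofReal_mul (by linarith), edist_dist]
    exact ENNReal.ofReal_le_ofReal (dist_le_mul_expDist hA hD z)
  · rw [lintegral_ofReal_ifsKernel hw0 measurable_expDist (expDist_nonneg (by linarith)),
      ← ENNReal.ofReal_mul hθ.1.le]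
    exact ENNReal.ofReal_le_ofReal
      (sum_pairWeight_mul_expDist_le hA hκA hβ1.le hp0 hp1 hlog hF hD z)

end ContractingIfs

section BestReply

variable {A B : Type*} [Fintype A] [Fintype B]

theorem bestReplies_nonempty [Nonempty A] (u : A → B → ℝ) (σ : B → ℝ) :
    (bestReplies u σ).Nonempty := by
  obtain ⟨a, ha⟩ := Finite.exists_max (expectedPayoff u σ)
  exact ⟨a, by simp [bestReplies, ha]⟩

theorem bestReplyProb_nonneg (u : A → B → ℝ) (σ : B → ℝ) (a : A) : 0 ≤ bestReplyProb u σ a := by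
  unfold bestReplyProb
  split_ifs <;> positivity

theorem sum_bestReplyProb [Nonempty A] (u : A → B → ℝ) (σ : B → ℝ) :
    ∑ a, bestReplyProb u σ a = 1 := by
  classical
  have h : ((bestReplies u σ).card : ℝ) ≠ 0 :=
    Nat.cast_ne_zero.2 (Finset.card_ne_zero.2 (bestReplies_nonempty u σ))
  simp only [bestReplyProb]
  rw [Finset.sum_ite_mem, Finset.univ_inter, Finset.sum_const, nsmul_eq_mul, mul_one_div_cancel h]

variable {u : A → B → ℝ} {k : ℕ} {ε : ℝ} {p : B → ℝ}

theorem sum_playProb [Nonempty A] (hp : p ∈ stdSimplex ℝ B) : ∑ a, playProb u k ε p a = 1 := by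
  have hA : (Fintype.card A : ℝ) ≠ 0 := Nat.cast_ne_zero.2 Fintype.card_ne_zero
  have hω : ∑ ω : Fin k → B, ∏ j, p (ω j) = 1 := by
    rw [← Fintype.prod_sum fun (_ : Fin k) b => p b]
    simp [hp.2]
  simp only [playProb, Finset.sum_add_distrib, ← Finset.mul_sum]
  rw [Finset.sum_comm]
  simp only [← Finset.mul_sum, sum_bestReplyProb, mul_one]
  rw [hω, Finset.sum_const, Finset.card_univ, nsmul_eq_mul, mul_div_cancel₀ _ hA]
  ring

theorem le_playProb (hp : p ∈ stdSimplex ℝ B) (hε : ε ≤ 1) (a : A) :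
    ε / Fintype.card A ≤ playProb u k ε p a := by
  refine le_add_of_nonneg_left (mul_nonneg (sub_nonneg.2 hε) ?_)
  exact Finset.sum_nonneg fun ω _ =>
    mul_nonneg (Finset.prod_nonneg fun j _ => hp.1 _) (bestReplyProb_nonneg _ _ _)

end BestReply

section Chain

variable {S₁ S₂ : Type*} [Fintype S₁] [Fintype S₂]

theorem isCompact_square : IsCompact {x : EuclideanSpace ℝ (S₁ ⊕ S₂) |
    (fun s => x (Sum.inl s)) ∈ stdSimplex ℝ S₁ ∧ (fun s => x (Sum.inr s)) ∈ stdSimplex ℝ S₂} := by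
  let join (q : (S₁ → ℝ) × (S₂ → ℝ)) : EuclideanSpace ℝ (S₁ ⊕ S₂) :=
    WithLp.toLp 2 (Sum.elim q.1 q.2)
  have hjoin : Continuous join := by
    refine (PiLp.continuous_toLp 2 _).comp (continuous_pi ?_)
    rintro (s | s) <;> simp only [Sum.elim_inl, Sum.elim_inr] <;> fun_prop
  convert ((isCompact_stdSimplex ℝ S₁).prod (isCompact_stdSimplex ℝ S₂)).image hjoin using 1
  ext x
  constructor
  · rintro ⟨h₁, h₂⟩
    refine ⟨(fun s => x (Sum.inl s), fun s => x (Sum.inr s)), ⟨h₁, h₂⟩, ?_⟩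
    ext (s | s) <;> rfl
  · rintro ⟨q, ⟨h₁, h₂⟩, rfl⟩
    exact ⟨h₁, h₂⟩

instance compactSpace_square : CompactSpace (Square S₁ S₂) :=
  isCompact_iff_compactSpace.1 isCompact_square

instance nonempty_square [Nonempty S₁] [Nonempty S₂] : Nonempty (Square S₁ S₂) := by
  classical
  obtain ⟨s₁⟩ := ‹Nonempty S₁›
  obtain ⟨s₂⟩ := ‹Nonempty S₂›
  exact ⟨⟨WithLp.toLp 2 (Sum.elim (Pi.single s₁ 1) (Pi.single s₂ 1)),
    single_mem_stdSimplex ℝ s₁, single_mem_stdSimplex ℝ s₂⟩⟩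

theorem dist_square_le (x y : Square S₁ S₂) :
    dist x y ≤ 2 * ⨆ z : Square S₁ S₂, ‖(z : EuclideanSpace ℝ (S₁ ⊕ S₂))‖ := by
  have hbdd : BddAbove (Set.range fun z : Square S₁ S₂ => ‖(z : EuclideanSpace ℝ (S₁ ⊕ S₂))‖) :=
    (isCompact_range (by fun_prop)).bddAbove
  calc dist x y ≤ ‖(x : EuclideanSpace ℝ (S₁ ⊕ S₂))‖ + ‖(y : EuclideanSpace ℝ (S₁ ⊕ S₂))‖ :=
        dist_le_norm_add_norm x.1 y.1
    _ ≤ 2 * ⨆ z : Square S₁ S₂, ‖(z : EuclideanSpace ℝ (S₁ ⊕ S₂))‖ := by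
        rw [two_mul]
        exact add_le_add (le_ciSup hbdd x) (le_ciSup hbdd y)

namespace Model

variable (M : Model S₁ S₂)

theorem dist_next (x y : Square S₁ S₂) (s₁ : S₁) (s₂ : S₂) :
    dist (M.next x s₁ s₂) (M.next y s₁ s₂) = M.β * dist x y := by
  have hsub : (M.next x s₁ s₂).1 - (M.next y s₁ s₂).1 = M.β • (x.1 - y.1) := by
    ext (s | s) <;> simp [next, Square.p₁, Square.p₂] <;> ring
  rw [Subtype.dist_eq, Subtype.dist_eq, dist_eq_norm, dist_eq_norm, hsub, norm_smul,
    Real.norm_of_nonneg M.β_mem.1.le]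

theorem continuous_next (s₁ : S₁) (s₂ : S₂) : Continuous fun x => M.next x s₁ s₂ :=
  (LipschitzWith.of_dist_le_mul (K := ⟨M.β, M.β_mem.1.le⟩)
    fun x y => (M.dist_next x y s₁ s₂).le).continuous

theorem exists_lipschitzWith_profileProb :
    ∃ K : ℝ≥0, ∀ s₁ s₂, LipschitzWith K fun x => M.profileProb x s₁ s₂ := by
  have hlip (s : S₁ × S₂) : ∃ K : ℝ≥0, LipschitzWith K fun x => M.profileProb x s.1 s.2 := by
    have hsmooth : ContDiff ℝ 1 fun x : EuclideanSpace ℝ (S₁ ⊕ S₂) =>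
        playProb M.u₁ M.k M.ε (fun s => x (Sum.inr s)) s.1 *
          playProb (fun b a => M.u₂ a b) M.k M.ε (fun s => x (Sum.inl s)) s.2 := by
      unfold playProb
      fun_prop
    obtain ⟨K, hK⟩ := hsmooth.locallyLipschitz.locallyLipschitzOn.exists_lipschitzOnWith_of_compact
      (isCompact_square (S₁ := S₁) (S₂ := S₂))
    exact ⟨K, hK.to_restrict⟩
  choose K hK using hlip
  exact ⟨Finset.univ.sup K, fun s₁ s₂ => (hK (s₁, s₂)).weaken (Finset.le_sup (Finset.mem_univ _))⟩

theorem le_profileProb (x : Square S₁ S₂) (s₁ : S₁) (s₂ : S₂) :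
    M.ε / Fintype.card S₁ * (M.ε / Fintype.card S₂) ≤ M.profileProb x s₁ s₂ := by
  have hε := M.ε_mem.1
  have h₁ : _ ≤ playProb M.u₁ M.k M.ε x.p₂ s₁ := le_playProb x.2.2 M.ε_mem.2 s₁
  have h₂ : _ ≤ playProb (fun b a => M.u₂ a b) M.k M.ε x.p₁ s₂ := le_playProb x.2.1 M.ε_mem.2 s₂
  exact mul_le_mul h₁ h₂ (by positivity) (le_trans (by positivity) h₁)

theorem profileProb_nonneg (x : Square S₁ S₂) (s₁ : S₁) (s₂ : S₂) : 0 ≤ M.profileProb x s₁ s₂ := by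
  have hε := M.ε_mem.1
  exact le_trans (by positivity) (M.le_profileProb x s₁ s₂)

theorem sum_profileProb [Nonempty S₁] [Nonempty S₂] (x : Square S₁ S₂) :
    ∑ s : S₁ × S₂, M.profileProb x s.1 s.2 = 1 := by
  have h₁ : ∑ s, playProb M.u₁ M.k M.ε x.p₂ s = 1 := sum_playProb x.2.2
  have h₂ : ∑ s, playProb (fun b a => M.u₂ a b) M.k M.ε x.p₁ s = 1 := sum_playProb x.2.1
  rw [Fintype.sum_prod_type]
  simp only [profileProb, ← Finset.mul_sum, h₂, mul_one, h₁]

theorem kernel_eq_ifsKernel :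
    M.kernel = ifsKernel (fun (s : S₁ × S₂) x => M.profileProb x s.1 s.2)
      (fun s x => M.next x s.1 s.2) (fun s => M.measurable_profileProb s.1 s.2)
      (fun s => M.measurable_next s.1 s.2) := by
  refine Kernel.ext fun x => ?_
  exact (Fintype.sum_prod_type fun s : S₁ × S₂ =>
    ENNReal.ofReal (M.profileProb x s.1 s.2) • Measure.dirac (M.next x s.1 s.2)).symm

instance isMarkovKernel_kernel [Nonempty S₁] [Nonempty S₂] : IsMarkovKernel M.kernel := by
  rw [M.kernel_eq_ifsKernel]
  exact isMarkovKernel_ifsKernel (fun s x => M.profileProb_nonneg x s.1 s.2) M.sum_profileProb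

theorem isFeller_kernel : IsFeller M.kernel := by
  obtain ⟨K, hK⟩ := M.exists_lipschitzWith_profileProb
  rw [M.kernel_eq_ifsKernel]
  exact isFeller_ifsKernel (fun s => (hK s.1 s.2).continuous) fun s => M.continuous_next s.1 s.2

theorem exists_mixesGeometrically_kernel [Nonempty S₁] [Nonempty S₂] (hε : 0 < M.ε) {D : ℝ}
    (hD0 : 0 ≤ D) (hD : ∀ x y : Square S₁ S₂, dist x y ≤ D) :
    ∃ θ ∈ Set.Ioo (0 : ℝ) 1, MixesGeometrically M.kernel (D + 1) θ := by
  obtain ⟨K, hK⟩ := M.exists_lipschitzWith_profileProb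
  have hδ : 0 < M.ε / Fintype.card S₁ * (M.ε / Fintype.card S₂) := by positivity
  have hlog (s : S₁ × S₂) (x y : Square S₁ S₂) :
      Real.exp (-(K / (M.ε / Fintype.card S₁ * (M.ε / Fintype.card S₂)) * dist x y)) *
        M.profileProb x s.1 s.2 ≤ M.profileProb y s.1 s.2 :=
    exp_neg_mul_le_of_lipschitzWith (hK s.1 s.2) hδ (fun x => M.le_profileProb x s.1 s.2) x y
  have hnext (s : S₁ × S₂) (x y : Square S₁ S₂) :
      dist (M.next x s.1 s.2) (M.next y s.1 s.2) ≤ M.β * dist x y :=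
    (M.dist_next x y s.1 s.2).le
  rw [M.kernel_eq_ifsKernel]
  exact exists_mixesGeometrically_ifsKernel
    (p := fun (s : S₁ × S₂) x => M.profileProb x s.1 s.2) (F := fun s x => M.next x s.1 s.2)
    M.β_mem.1.le M.β_mem.2 (fun s x => M.profileProb_nonneg x s.1 s.2) M.sum_profileProb
    hlog hnext hD0 hD _ _

end Model

end Chain

end RWS

end

theorem theorem1_general :
    ∃ c : ℝ → ℝ → ℝ, (∀ R α, 0 < c R α) ∧
      ∀ (S₁ S₂ : Type*) [Fintype S₁] [Fintype S₂] [Nonempty S₁] [Nonempty S₂]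
        (M : RWS.Model S₁ S₂),
        0 < M.ε →
        ∃ θ ∈ Set.Ioo (0 : ℝ) 1, ∃ μ : Measure (RWS.Square S₁ S₂),
          (IsProbabilityMeasure μ ∧ M.kernel.Invariant μ) ∧
          (∀ μ' : Measure (RWS.Square S₁ S₂),
            IsProbabilityMeasure μ' → M.kernel.Invariant μ' → μ' = μ) ∧
          ∀ α : ℝ, 1 ≤ α → ∀ ν : Measure (RWS.Square S₁ S₂), IsProbabilityMeasure ν → ∀ n : ℕ,
            RWS.wasserstein α (ν.bind ⇑(M.kernel ^ n)) μ ^ α ≤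
              ENNReal.ofReal (c (⨆ x : RWS.Square S₁ S₂, ‖(x : EuclideanSpace ℝ (S₁ ⊕ S₂))‖) α
                * θ ^ n) := by
  refine ⟨fun R α => (2 * |R| + 1) ^ α, fun R α => by positivity, ?_⟩
  intro S₁ S₂ _ _ _ _ M hε
  set R := ⨆ x : RWS.Square S₁ S₂, ‖(x : EuclideanSpace ℝ (S₁ ⊕ S₂))‖
  have hdiam (x y : RWS.Square S₁ S₂) : dist x y ≤ 2 * |R| :=
    (RWS.dist_square_le x y).trans (by gcongr; exact le_abs_self R)
  obtain ⟨θ, hθ, hmix⟩ := M.exists_mixesGeometrically_kernel hε (by positivity) hdiam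
  obtain ⟨μ, hμ, hinv⟩ := hmix.exists_invariant hθ M.isFeller_kernel
  refine ⟨θ, hθ, μ, ⟨hμ, hinv⟩, fun μ' _ hinv' => hmix.invariant_unique hθ hinv hinv',
    fun α hα ν _ n => ?_⟩
  calc RWS.wasserstein α (ν.bind ⇑(M.kernel ^ n)) μ ^ α
      ≤ ENNReal.ofReal ((2 * |R| + 1) ^ (α - 1) * ((2 * |R| + 1) * θ ^ n)) :=
        hmix.wasserstein_rpow_le (fun x y => (hdiam x y).trans (by linarith)) (by positivity)
          hinv hα ν n
    _ = ENNReal.ofReal ((2 * |R| + 1) ^ α * θ ^ n) := by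
        rw [← mul_assoc, ← Real.rpow_add_one (by positivity), sub_add_cancel]

theorem theorem1 :
    ∃ c : ℝ → ℝ → ℝ, (∀ R α, 0 < c R α) ∧
      ∀ (S₁ S₂ : Type*) [Fintype S₁] [Fintype S₂] [Nonempty S₁] [Nonempty S₂]
        (M : RWS.Model S₁ S₂),
        0 < M.ε →
        M.β ∈ Set.Ioo (1 - ((max (Fintype.card S₁) (Fintype.card S₂) : ℕ) : ℝ)⁻¹) 1 →
        ∃ θ ∈ Set.Ioo (0 : ℝ) 1, ∃ μ : Measure (RWS.Square S₁ S₂),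
          (IsProbabilityMeasure μ ∧ M.kernel.Invariant μ) ∧
          (∀ μ' : Measure (RWS.Square S₁ S₂),
            IsProbabilityMeasure μ' → M.kernel.Invariant μ' → μ' = μ) ∧
          ∀ α : ℝ, 1 ≤ α → ∀ ν : Measure (RWS.Square S₁ S₂), IsProbabilityMeasure ν → ∀ n : ℕ,
            RWS.wasserstein α (ν.bind ⇑(M.kernel ^ n)) μ ^ α ≤
              ENNReal.ofReal (c (⨆ x : RWS.Square S₁ S₂, ‖(x : EuclideanSpace ℝ (S₁ ⊕ S₂))‖) α
                * θ ^ n) := by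
  obtain ⟨c, hc, h⟩ := theorem1_general
  exact ⟨c, hc, fun S₁ S₂ _ _ _ _ M hε _ => h S₁ S₂ M hε⟩
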